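/- Fix $\mathtt{w}\in\mathbb{N}$. A (linear differential) behavior in $\mathtt{w}$ variables is a set of the form $\mathfrak{B}=\ker R(\tfrac{d}{dt})=\{w\in C^\infty(\mathbb{R},\mathbb{R}^{\mathtt{w}}) : R(\tfrac{d}{dt})w=0\}$, where $R$ is a real polynomial matrix with $\mathtt{w}$ columns; its input cardinality is $\mathtt{m}(\mathfrak{B})=\mathtt{w}-\operatorname{rank}R$, which depends only on $\mathfrak{B}$, and $\mathfrak{B}$ is autonomous if $\mathtt{m}(\mathfrak{B})=0$. A behavior $\mathfrak{B}$ is controllable if for all $w_1,w_2\in\mathfrak{B}$ there are $w_3\in\mathfrak{B}$ and $\tau>0$ with $w_3(t)=w_1(t)$ for all $t\le 0$ and $w_3(t)=w_2(t)$ for all $t\ge\tau$. For a real symmetric matrix $S\in\mathbb{R}^{\mathtt{w}\times\mathtt{w}}$, a behavior $\mathfrak{B}$ is $S$-dissipative if there is a quadratic differential form $Q_\Psi(w)=\sum_{j,k}(w^{(j)})^T\Psi_{jk}\,w^{(k)}$ (a finite sum with $\Psi_{jk}\in\mathbb{R}^{\mathtt{w}\times\mathtt{w}}$) such that $\tfrac{d}{dt}Q_\Psi(w)\le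 w^TSw$ on $\mathbb{R}$ for all $w\in\mathfrak{B}$; it is strictly $S$-dissipative if it is $(S-\varepsilon I)$-dissipative for some $\varepsilon>0$. **Theorem.** Let $\Sigma\in\mathbb{R}^{\mathtt{w}\times\mathtt{w}}$ be nonsingular, symmetric and indefinite (that is, $x^T\Sigma x$ takes both positive and negative values). Then there exists a behavior $\mathfrak{B}\neq\{0\}$ in $\mathtt{w}$ variables such that $(\ast)$ there are controllable behaviors $\mathfrak{B}_+$ and $\mathfrak{B}_-$ in $\mathtt{w}$ variables with $\mathfrak{B}=\mathfrak{B}_+\cap\mathfrak{B}_-$, where $\mathfrak{B}_+$ is strictly $\Sigma$-dissipative and $\mathfrak{B}_-$ is strictly $(-\Sigma)$-dissipative. Further, every behavior $\mathfrak{B}$ in $\mathtt{w}$ variables that satisfies $(\ast)$ has $\mathtt{m}(\mathfrak{B})=0$, i.e. is autonomous. -/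

import Mathlib

open scoped ContDiff Polynomial Matrix

noncomputable section

namespace Behavioral

/-- The differential operator `R(d/dt)` of a real polynomial matrix `R`, applied to a
trajectory `w`: the `i`-th entry is `∑ j, ∑ k, (coefficient of ξ ^ k in R i j) * w_j^(k)`. -/
def diffOp {p n : ℕ} (R : Matrix (Fin p) (Fin n) ℝ[X]) (w : ℝ → Fin n → ℝ) :
    ℝ → Fin p → ℝ :=
  fun t i => ∑ j, (R i j).sum fun k a => a * iteratedDeriv k w t j

/-- The set of smooth solutions of `R(d/dt) w = 0`. -/
def kerBehavior {p n : ℕ} (R : Matrix (Fin p) (Fin n) ℝ[X]) : Set (ℝ → Fin n → ℝ) :=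
  {w | ContDiff ℝ ∞ w ∧ ∀ t, diffOp R w t = 0}

/-- Linear differential behaviors with `n` variables. -/
def IsBehavior {n : ℕ} (B : Set (ℝ → Fin n → ℝ)) : Prop :=
  ∃ (p : ℕ) (R : Matrix (Fin p) (Fin n) ℝ[X]), B = kerBehavior R

/-- `B` is a linear differential behavior with input cardinality `m`: the number of variables
minus the rank of the polynomial matrix is `m`, in every kernel representation of `B`. -/
def HasInputCardinality {n : ℕ} (B : Set (ℝ → Fin n → ℝ)) (m : ℕ) : Prop :=
  IsBehavior B ∧
    ∀ (p : ℕ) (R : Matrix (Fin p) (Fin n) ℝ[X]), B = kerBehavior R → R.rank + m = n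

/-- A behavior is autonomous if its input cardinality is zero. -/
def IsAutonomous {n : ℕ} (B : Set (ℝ → Fin n → ℝ)) : Prop :=
  HasInputCardinality B 0

/-- Controllability: any past in `B` can be patched, inside `B`, to any future in `B`. -/
def IsControllable {n : ℕ} (B : Set (ℝ → Fin n → ℝ)) : Prop :=
  ∀ w₁ ∈ B, ∀ w₂ ∈ B, ∃ w₃ ∈ B, ∃ τ : ℝ, 0 < τ ∧
    (∀ t, t ≤ 0 → w₃ t = w₁ t) ∧ (∀ t, τ ≤ t → w₃ t = w₂ t)

/-- The quadratic differential form induced by the two-variable polynomial matrix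
`Φ(ζ, η) = ∑ Φ_{jk} ζ ^ j η ^ k`, given by its finitely many nonzero coefficient matrices. -/
def qdf {n : ℕ} (Φ : (ℕ × ℕ) →₀ Matrix (Fin n) (Fin n) ℝ) (w : ℝ → Fin n → ℝ) : ℝ → ℝ :=
  fun t => Φ.sum fun jk P => iteratedDeriv jk.1 w t ⬝ᵥ (P *ᵥ iteratedDeriv jk.2 w t)

/-- `B` is dissipative with respect to the supply rate `wᵀ S w`: there is a quadratic
differential form (a storage function) satisfying the dissipation inequality along `B`. -/
def IsDissipative {n : ℕ} (S : Matrix (Fin n) (Fin n) ℝ) (B : Set (ℝ → Fin n → ℝ)) : Prop :=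
  ∃ Ψ : (ℕ × ℕ) →₀ Matrix (Fin n) (Fin n) ℝ,
    ∀ w ∈ B, ∀ t, deriv (qdf Ψ w) t ≤ w t ⬝ᵥ (S *ᵥ w t)

/-- Strict dissipativity: for some `ε > 0`, dissipativity with respect to the supply rate
`wᵀ S w - ε |w|²` (Euclidean norm). -/
def IsStrictlyDissipative {n : ℕ} (S : Matrix (Fin n) (Fin n) ℝ)
    (B : Set (ℝ → Fin n → ℝ)) : Prop :=
  ∃ ε : ℝ, 0 < ε ∧ IsDissipative (S - ε • (1 : Matrix (Fin n) (Fin n) ℝ)) B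

/-- The quadratic form of `S` takes both positive and negative values. -/
def IsIndefinite {n : ℕ} (S : Matrix (Fin n) (Fin n) ℝ) : Prop :=
  (∃ x : Fin n → ℝ, 0 < x ⬝ᵥ (S *ᵥ x)) ∧ (∃ y : Fin n → ℝ, y ⬝ᵥ (S *ᵥ y) < 0)

/-- The behavior `B` is the intersection of a controllable strictly `S`-dissipative behavior
and a controllable strictly `-S`-dissipative behavior. -/
def IsStrictIntersection {n : ℕ} (S : Matrix (Fin n) (Fin n) ℝ)
    (B : Set (ℝ → Fin n → ℝ)) : Prop :=
  IsBehavior B ∧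
    ∃ Bplus Bminus : Set (ℝ → Fin n → ℝ),
      (IsBehavior Bplus ∧ IsControllable Bplus ∧ IsStrictlyDissipative S Bplus) ∧
      (IsBehavior Bminus ∧ IsControllable Bminus ∧ IsStrictlyDissipative (-S) Bminus) ∧
      B = Bplus ∩ Bminus

end Behavioral

end

open Filter Topology

noncomputable section

namespace Behavioral

/-! Autonomy: along a common trajectory the sum of the two storage functions has derivative at most
a negative multiple of |w|². If w has compact support, this sum vanishes at both ends, so it is
constant and w = 0 (`eq_zero_of_strictlyDissipative`). A rank-deficient kernel representation would
contradict this: a polynomial vector in its kernel, applied to a bump function, gives a nonzero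
compactly supported trajectory.

Existence: take S-orthogonal u, v on which the form is positive and negative. The trajectories (f' +
c f) u + f v with f free form a controllable behavior. The cross term in (f' + c f)² is a total
derivative, hence storage, and for large c the term c² f² outweighs the negative part from v.
Swapping u and v serves -S, and e^{(1-c)t} (u + v) lies in both behaviors. -/

/-! ### Polynomial differential operators on smooth functions -/

/-- The space of smooth real functions on the line. -/
def smoothFun : Submodule ℝ (ℝ → ℝ) where
  carrier := {f | ContDiff ℝ ∞ f}
  add_mem' {f g} (hf : ContDiff ℝ ∞ f) (hg : ContDiff ℝ ∞ g) := hf.add hg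
  zero_mem' := contDiff_zero_fun (𝕜 := ℝ) (n := ∞)
  smul_mem' c f (hf : ContDiff ℝ ∞ f) := hf.const_smul c

lemma contDiff_coe (f : smoothFun) : ContDiff ℝ ∞ (f : ℝ → ℝ) := f.2

lemma differentiable_coe (f : smoothFun) : Differentiable ℝ (f : ℝ → ℝ) :=
  (contDiff_infty_iff_deriv.1 (contDiff_coe f)).1

/-- Differentiation as an endomorphism of the space of smooth functions. -/
def smoothDeriv : Module.End ℝ smoothFun where
  toFun f := ⟨deriv f, (contDiff_infty_iff_deriv.1 (contDiff_coe f)).2⟩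
  map_add' f g := by
    ext t
    exact deriv_add (differentiable_coe f t) (differentiable_coe g t)
  map_smul' c f := by
    ext t
    exact deriv_const_smul c (differentiable_coe f t)

@[simp] lemma smoothDeriv_apply (f : smoothFun) (t : ℝ) :
    (smoothDeriv f : ℝ → ℝ) t = deriv f t := rfl

lemma smoothDeriv_pow_apply (k : ℕ) (f : smoothFun) :
    (((smoothDeriv ^ k) f : smoothFun) : ℝ → ℝ) = iteratedDeriv k f := by
  induction k with
  | zero => simp
  | succ k ih =>
    rw [pow_succ', iteratedDeriv_succ, ← ih]
    rfl

lemma aeval_smoothDeriv_apply (P : ℝ[X]) (f : smoothFun) (t : ℝ) :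
    (Polynomial.aeval smoothDeriv P f : ℝ → ℝ) t = P.sum fun k a => a * iteratedDeriv k f t := by
  rw [Polynomial.aeval_eq_sum_range, Polynomial.sum_over_range _ (fun _ => by simp)]
  simp [LinearMap.sum_apply, Finset.sum_apply, smoothDeriv_pow_apply]

lemma iteratedDeriv_apply_coord {n : ℕ} {w : ℝ → Fin n → ℝ} (hw : ContDiff ℝ ∞ w) (k : ℕ)
    (t : ℝ) (j : Fin n) : iteratedDeriv k w t j = iteratedDeriv k (fun s => w s j) t := by
  induction k generalizing t with
  | zero => simp
  | succ k ih =>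
    have hd : Differentiable ℝ (iteratedDeriv k w) :=
      hw.differentiable_iteratedDeriv k (by exact_mod_cast WithTop.coe_lt_top k)
    rw [iteratedDeriv_succ, iteratedDeriv_succ, deriv_pi fun i => differentiableAt_pi.1 (hd t) i]
    simp only [ih]

lemma contDiff_of_coords {n : ℕ} (f : Fin n → smoothFun) :
    ContDiff ℝ ∞ (fun t j => (f j : ℝ → ℝ) t) :=
  contDiff_pi.2 fun j => contDiff_coe (f j)

lemma diffOp_eq_aeval {p n : ℕ} (R : Matrix (Fin p) (Fin n) ℝ[X]) (f : Fin n → smoothFun)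
    (t : ℝ) (i : Fin p) :
    diffOp R (fun t j => (f j : ℝ → ℝ) t) t i =
      ((∑ j, Polynomial.aeval smoothDeriv (R i j) (f j) : smoothFun) : ℝ → ℝ) t := by
  simp [diffOp, aeval_smoothDeriv_apply, Finset.sum_apply,
    iteratedDeriv_apply_coord (contDiff_of_coords f)]

/-- The trajectory `m(d/dt) f` generated from a latent scalar function `f`. -/
def image {n : ℕ} (m : Fin n → ℝ[X]) (f : smoothFun) : ℝ → Fin n → ℝ :=
  fun t j => (Polynomial.aeval smoothDeriv (m j) f : ℝ → ℝ) t

/-- Evaluation at d/dt is a ring homomorphism, so R(d/dt) m(d/dt) = (R m)(d/dt). -/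
lemma image_mem_kerBehavior {p n : ℕ} {R : Matrix (Fin p) (Fin n) ℝ[X]} {m : Fin n → ℝ[X]}
    (h : R *ᵥ m = 0) (f : smoothFun) : image m f ∈ kerBehavior R := by
  refine ⟨contDiff_of_coords _, fun t => funext fun i => ?_⟩
  have key : ∑ j, Polynomial.aeval smoothDeriv (R i j) (Polynomial.aeval smoothDeriv (m j) f)
      = 0 := by
    have := congrArg (fun P => Polynomial.aeval smoothDeriv P f) (congrFun h i)
    simpa [Matrix.mulVec, dotProduct, LinearMap.sum_apply] using this
  have := diffOp_eq_aeval R (fun j => Polynomial.aeval smoothDeriv (m j) f) t i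
  rw [key] at this
  exact this

lemma exists_mulVec_eq_zero_of_rank_ne {p n : ℕ} (R : Matrix (Fin p) (Fin n) ℝ[X])
    (h : R.rank ≠ n) : ∃ m : Fin n → ℝ[X], m ≠ 0 ∧ R *ᵥ m = 0 := by
  by_contra! H
  refine h ?_
  have hinj : Function.Injective R.mulVecLin :=
    (injective_iff_map_eq_zero _).2 fun m hm => by
      by_contra h0
      exact H m h0 hm
  simpa [Matrix.rank] using LinearMap.finrank_range_of_inj hinj

/-! ### Compactly supported test functions -/

/-- The monomial `t ^ k` cut off to a bounded interval around `0`. -/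
def cutoffPow (k : ℕ) : smoothFun :=
  ⟨fun t => t ^ k * (⟨1, 2, one_pos, one_lt_two⟩ : ContDiffBump (0 : ℝ)) t,
    (contDiff_id.pow k).mul (ContDiffBump.contDiff _)⟩

lemma cutoffPow_eventuallyEq (k : ℕ) : (cutoffPow k : ℝ → ℝ) =ᶠ[𝓝 0] fun t => t ^ k := by
  filter_upwards [(⟨1, 2, one_pos, one_lt_two⟩ : ContDiffBump (0 : ℝ)).eventuallyEq_one]
    with t ht
  simp [cutoffPow, ht]

lemma cutoffPow_eq_zero (k : ℕ) {t : ℝ} (ht : 2 ≤ |t|) : (cutoffPow k : ℝ → ℝ) t = 0 := by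
  have : (⟨1, 2, one_pos, one_lt_two⟩ : ContDiffBump (0 : ℝ)) t = 0 :=
    ContDiffBump.zero_of_le_dist _ (by simpa [Real.dist_eq] using ht)
  simp [cutoffPow, this]

lemma eventually_two_lt_abs {t : ℝ} (ht : 2 < |t|) : ∀ᶠ s in 𝓝 t, 2 < |s| :=
  continuous_abs.continuousAt.eventually (lt_mem_nhds ht)

lemma image_cutoffPow_eq_zero {n : ℕ} (m : Fin n → ℝ[X]) (k : ℕ) {t : ℝ} (ht : 2 < |t|) :
    image m (cutoffPow k) t = 0 := by
  have h : (cutoffPow k : ℝ → ℝ) =ᶠ[𝓝 t] fun _ => 0 := by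
    filter_upwards [eventually_two_lt_abs ht] with s hs using cutoffPow_eq_zero k hs.le
  ext j
  simp [image, aeval_smoothDeriv_apply, h.iteratedDeriv_eq, Polynomial.sum_def]

/-- Near 0 the cutoff is invisible, and only the k-th derivative of t^k survives at 0; this
certifies that the test trajectory is nonzero. -/
lemma image_cutoffPow_zero {n : ℕ} (m : Fin n → ℝ[X]) (k : ℕ) (j : Fin n) :
    image m (cutoffPow k) 0 j = (m j).coeff k * k.factorial := by
  have hne : ∀ i, i ≠ k → iteratedDeriv i (cutoffPow k : ℝ → ℝ) 0 = 0 := fun i hi => by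
    rw [(cutoffPow_eventuallyEq k).iteratedDeriv_eq, iteratedDeriv_pow]
    rcases lt_or_gt_of_ne hi with h | h
    · simp [Nat.sub_ne_zero_of_lt h]
    · simp [Nat.descFactorial_of_lt h]
  have heq : iteratedDeriv k (cutoffPow k : ℝ → ℝ) 0 = k.factorial := by
    rw [(cutoffPow_eventuallyEq k).iteratedDeriv_eq, iteratedDeriv_pow]
    simp [Nat.descFactorial_self]
  rw [image, aeval_smoothDeriv_apply, Polynomial.sum_def, Finset.sum_eq_single k, heq]
  · intro i _ hi
    rw [hne i hi, mul_zero]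
  · intro hk
    rw [Polynomial.notMem_support_iff.1 hk, zero_mul]

/-! ### Storage functions and autonomy -/

lemma differentiable_qdf {n : ℕ} (Φ : (ℕ × ℕ) →₀ Matrix (Fin n) (Fin n) ℝ)
    {w : ℝ → Fin n → ℝ} (hw : ContDiff ℝ ∞ w) : Differentiable ℝ (qdf Φ w) := by
  have hd : ∀ k i, Differentiable ℝ fun t => iteratedDeriv k w t i := fun k =>
    differentiable_pi.1
      (hw.differentiable_iteratedDeriv k (by exact_mod_cast WithTop.coe_lt_top k))
  exact Differentiable.fun_sum fun jk _ => Differentiable.fun_sum fun i _ =>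
    (hd jk.1 i).mul
      (show Differentiable ℝ fun t => ∑ j, Φ jk i j * iteratedDeriv jk.2 w t j from
        Differentiable.fun_sum fun j _ => (hd jk.2 j).const_mul _)

lemma qdf_eq_zero {n : ℕ} (Φ : (ℕ × ℕ) →₀ Matrix (Fin n) (Fin n) ℝ) {w : ℝ → Fin n → ℝ}
    {t : ℝ} (h : w =ᶠ[𝓝 t] fun _ => 0) : qdf Φ w t = 0 := by
  simp [qdf, h.iteratedDeriv_eq, Finsupp.sum]

lemma sub_smul_one_form {n : ℕ} (S : Matrix (Fin n) (Fin n) ℝ) (ε : ℝ) (x : Fin n → ℝ) :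
    x ⬝ᵥ ((S - ε • (1 : Matrix (Fin n) (Fin n) ℝ)) *ᵥ x) = x ⬝ᵥ (S *ᵥ x) - ε * (x ⬝ᵥ x) := by
  simp [Matrix.sub_mulVec, Matrix.smul_mulVec, dotProduct_sub, dotProduct_smul]

/-- A compactly supported trajectory that is strictly dissipated with respect to both `S` and
`-S` vanishes. -/
lemma eq_zero_of_strictlyDissipative {n : ℕ} {S : Matrix (Fin n) (Fin n) ℝ}
    {B C : Set (ℝ → Fin n → ℝ)} (hB : IsStrictlyDissipative S B)
    (hC : IsStrictlyDissipative (-S) C) {w : ℝ → Fin n → ℝ} (hw : ContDiff ℝ ∞ w)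
    (hwB : w ∈ B) (hwC : w ∈ C) {T : ℝ} (hsupp : ∀ t, T < |t| → w t = 0) (t : ℝ) : w t = 0 := by
  obtain ⟨ε, hε, Φ, hΦ⟩ := hB
  obtain ⟨δ, hδ, Ψ, hΨ⟩ := hC
  have hdiff := (differentiable_qdf Φ hw).add (differentiable_qdf Ψ hw)
  have hder : ∀ s, deriv (qdf Φ w + qdf Ψ w) s ≤ -(ε + δ) * (w s ⬝ᵥ w s) := fun s => by
    rw [deriv_add (differentiable_qdf Φ hw s) (differentiable_qdf Ψ hw s)]
    have h1 := hΦ w hwB s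
    have h2 := hΨ w hwC s
    rw [sub_smul_one_form] at h1 h2
    rw [Matrix.neg_mulVec, dotProduct_neg] at h2
    linarith
  have hnn : ∀ s, 0 ≤ w s ⬝ᵥ w s := fun s => Finset.sum_nonneg fun i _ => mul_self_nonneg _
  have hanti : Antitone (qdf Φ w + qdf Ψ w) :=
    antitone_of_deriv_nonpos hdiff fun s => (hder s).trans (by nlinarith [hnn s])
  have hfar : ∀ s, T < |s| → (qdf Φ w + qdf Ψ w) s = 0 := fun s hs => by
    have h0 : w =ᶠ[𝓝 s] fun _ => 0 := by
      filter_upwards [continuous_abs.continuousAt.eventually (lt_mem_nhds hs)] with r hr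
      exact hsupp r hr
    simp [qdf_eq_zero _ h0]
  -- A decreasing function that vanishes far to the left and far to the right is squeezed to zero.
  have hzero : qdf Φ w + qdf Ψ w = fun _ => 0 := by
    funext s
    have hT : T < |(|s| + |T| + 1)| := by
      rw [abs_of_pos (by positivity)]
      linarith [le_abs_self T, abs_nonneg s]
    refine le_antisymm ?_ ?_
    · rw [← hfar (-(|s| + |T| + 1)) (by rwa [abs_neg])]
      exact hanti (by linarith [neg_abs_le s, abs_nonneg T])
    · rw [← hfar _ hT]
      exact hanti (by linarith [le_abs_self s, abs_nonneg T])
  have := hder t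
  rw [hzero, deriv_const] at this
  exact dotProduct_self_eq_zero.1 (le_antisymm (by nlinarith) (hnn t))

theorem IsStrictIntersection.isAutonomous {n : ℕ} {S : Matrix (Fin n) (Fin n) ℝ}
    {B : Set (ℝ → Fin n → ℝ)} (hB : IsStrictIntersection S B) : IsAutonomous B := by
  obtain ⟨hbeh, P, N, ⟨-, -, hP⟩, ⟨-, -, hN⟩, hPN⟩ := hB
  refine ⟨hbeh, fun p R hR => ?_⟩
  by_contra hrank
  obtain ⟨m, hm, hRm⟩ := exists_mulVec_eq_zero_of_rank_ne R hrank
  obtain ⟨j, hj⟩ := Function.ne_iff.1 hm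
  obtain ⟨k, hk⟩ : ∃ k, (m j).coeff k ≠ 0 := by
    by_contra! h
    exact hj (Polynomial.ext h)
  have hker := image_mem_kerBehavior hRm (cutoffPow k)
  have hmem : image m (cutoffPow k) ∈ P ∩ N := by rwa [← hPN, hR]
  have h0 := eq_zero_of_strictlyDissipative hP hN hker.1 hmem.1 hmem.2
    (fun t ht => image_cutoffPow_eq_zero m k ht) 0
  have := congrFun h0 j
  rw [image_cutoffPow_zero, Pi.zero_apply] at this
  exact mul_ne_zero hk (by positivity) this

/-! ### First-order behaviors with one latent function -/

/-- The kernel representation of the trajectories `w = (f' + c f) u + f v` with `f = β ⬝ᵥ w`. -/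
def firstOrderMatrix {n : ℕ} (u v β : Fin n → ℝ) (c : ℝ) : Matrix (Fin n) (Fin n) ℝ[X] :=
  Matrix.of fun i j => Polynomial.C ((1 : Matrix (Fin n) (Fin n) ℝ) i j)
    - Polynomial.C (u i * β j) * (Polynomial.X + Polynomial.C c) - Polynomial.C (v i * β j)

/-- The trajectory `(f' + c f) u + f v`. -/
def firstOrderTraj {n : ℕ} (u v : Fin n → ℝ) (c : ℝ) (f : ℝ → ℝ) : ℝ → Fin n → ℝ :=
  fun t => (deriv f t + c * f t) • u + f t • v

lemma contDiff_firstOrderTraj {n : ℕ} (u v : Fin n → ℝ) (c : ℝ) {f : ℝ → ℝ}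
    (hf : ContDiff ℝ ∞ f) : ContDiff ℝ ∞ (firstOrderTraj u v c f) := by
  have hd := (contDiff_infty_iff_deriv.1 hf).2
  exact ((hd.add (contDiff_const.mul hf)).smul contDiff_const).add (hf.smul contDiff_const)

lemma contDiff_dotProduct {n : ℕ} (β : Fin n → ℝ) {w : ℝ → Fin n → ℝ} (hw : ContDiff ℝ ∞ w) :
    ContDiff ℝ ∞ fun t => β ⬝ᵥ w t :=
  ContDiff.sum fun i _ => contDiff_const.mul (contDiff_pi.1 hw i)

lemma mem_firstOrder_iff {n : ℕ} {u v β : Fin n → ℝ} {c : ℝ} {w : ℝ → Fin n → ℝ} :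
    w ∈ kerBehavior (firstOrderMatrix u v β c) ↔
      ContDiff ℝ ∞ w ∧ w = firstOrderTraj u v c fun t => β ⬝ᵥ w t := by
  refine and_congr_right fun hw => ?_
  have hcoord : ∀ t i, diffOp (firstOrderMatrix u v β c) w t i =
      w t i - firstOrderTraj u v c (fun t => β ⬝ᵥ w t) t i := by
    intro t i
    let f : Fin n → smoothFun := fun j => ⟨fun t => w t j, contDiff_pi.1 hw j⟩
    have hder : deriv (fun t => β ⬝ᵥ w t) t = ∑ j, β j * deriv (fun s => w s j) t := by
      simp only [dotProduct]
      rw [deriv_fun_sum fun j _ => (differentiable_coe (f j) t).const_mul (β j)]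
      exact Finset.sum_congr rfl fun j _ => deriv_const_mul _ (differentiable_coe (f j) t)
    have hR : ∀ j, ((Polynomial.aeval smoothDeriv (firstOrderMatrix u v β c i j) (f j) :
        smoothFun) : ℝ → ℝ) t = (1 : Matrix (Fin n) (Fin n) ℝ) i j * w t j
          - u i * (β j * deriv (fun s => w s j) t + c * (β j * w t j))
          - v i * (β j * w t j) := by
      intro j
      simp [firstOrderMatrix, f, Module.algebraMap_end_apply]
      ring
    refine (diffOp_eq_aeval _ f t i).trans ?_
    rw [AddSubmonoidClass.coe_finsetSum, Finset.sum_apply, Finset.sum_congr rfl fun j _ => hR j]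
    simp only [Finset.sum_sub_distrib, Finset.sum_add_distrib, ← Finset.mul_sum, Matrix.one_apply,
      firstOrderTraj, hder, Pi.add_apply, Pi.smul_apply, smul_eq_mul]
    simp [dotProduct]
    ring
  constructor
  · intro h
    funext t i
    have := congrFun (h t) i
    rw [hcoord] at this
    exact sub_eq_zero.1 this
  · intro h t
    funext i
    rw [hcoord]
    exact sub_eq_zero.2 (congrFun (congrFun h t) i)

lemma firstOrderTraj_mem {n : ℕ} {u v β : Fin n → ℝ} (c : ℝ) (hu : β ⬝ᵥ u = 0)
    (hv : β ⬝ᵥ v = 1) {f : ℝ → ℝ} (hf : ContDiff ℝ ∞ f) :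
    firstOrderTraj u v c f ∈ kerBehavior (firstOrderMatrix u v β c) := by
  refine mem_firstOrder_iff.2 ⟨contDiff_firstOrderTraj u v c hf, ?_⟩
  congr 1
  funext t
  simp [firstOrderTraj, dotProduct_add, dotProduct_smul, hu, hv]

lemma isControllable_firstOrder {n : ℕ} {u v β : Fin n → ℝ} (c : ℝ) (hu : β ⬝ᵥ u = 0)
    (hv : β ⬝ᵥ v = 1) : IsControllable (kerBehavior (firstOrderMatrix u v β c)) := by
  intro w₁ h₁ w₂ h₂
  obtain ⟨hs₁, e₁⟩ := mem_firstOrder_iff.1 h₁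
  obtain ⟨hs₂, e₂⟩ := mem_firstOrder_iff.1 h₂
  -- The transition occupies [1, 2], strictly inside (0, 3), so f has the germ of the old or new
  -- latent function at every t ≤ 0 or t ≥ 3, and its derivative agrees there too.
  let σ : ℝ → ℝ := fun t => Real.smoothTransition (t - 1)
  let f : ℝ → ℝ := fun t => β ⬝ᵥ w₁ t + σ t * (β ⬝ᵥ w₂ t - β ⬝ᵥ w₁ t)
  have hσ : ContDiff ℝ ∞ σ :=
    Real.smoothTransition.contDiff.comp (contDiff_id.sub contDiff_const)
  have hf : ContDiff ℝ ∞ f := (contDiff_dotProduct β hs₁).add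
    (hσ.mul ((contDiff_dotProduct β hs₂).sub (contDiff_dotProduct β hs₁)))
  have hloc : ∀ {g : ℝ → ℝ} {t : ℝ}, f =ᶠ[𝓝 t] g →
      firstOrderTraj u v c f t = firstOrderTraj u v c g t := fun h => by
    simp only [firstOrderTraj, h.deriv_eq, h.eq_of_nhds]
  refine ⟨firstOrderTraj u v c f, firstOrderTraj_mem c hu hv hf, 3, by norm_num, ?_, ?_⟩
  · intro t ht
    conv_rhs => rw [e₁]
    refine hloc ?_
    filter_upwards [gt_mem_nhds (show t < 1 by linarith)] with s hs
    simp [f, σ, Real.smoothTransition.zero_of_nonpos (sub_nonpos.2 hs.le)]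
  · intro t ht
    conv_rhs => rw [e₂]
    refine hloc ?_
    filter_upwards [lt_mem_nhds (show 2 < t by linarith)] with s hs
    simp [f, σ, Real.smoothTransition.one_of_one_le (show (1 : ℝ) ≤ s - 1 by linarith)]

/-! ### Strict dissipativity for large c -/

lemma dotProduct_mulVec_comm_of_isSymm {n : ℕ} {S : Matrix (Fin n) (Fin n) ℝ} (hS : S.IsSymm)
    (x y : Fin n → ℝ) : x ⬝ᵥ (S *ᵥ y) = y ⬝ᵥ (S *ᵥ x) := by
  rw [Matrix.dotProduct_mulVec, ← Matrix.mulVec_transpose, hS.eq, dotProduct_comm]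

lemma form_add_of_orthogonal {n : ℕ} {S : Matrix (Fin n) (Fin n) ℝ} {u v : Fin n → ℝ}
    (huv : u ⬝ᵥ (S *ᵥ v) = 0) (hvu : v ⬝ᵥ (S *ᵥ u) = 0) (a b : ℝ) :
    (a • u + b • v) ⬝ᵥ (S *ᵥ (a • u + b • v)) =
      a ^ 2 * (u ⬝ᵥ (S *ᵥ u)) + b ^ 2 * (v ⬝ᵥ (S *ᵥ v)) := by
  simp only [Matrix.mulVec_add, Matrix.mulVec_smul, dotProduct_add, add_dotProduct,
    smul_dotProduct, dotProduct_smul, huv, hvu, smul_eq_mul]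
  ring

/-- Nonnegativity of |a u - b v|² controls the cross term. The extra 1 makes the constant positive,
so that it can be divided by. -/
lemma dotProduct_self_le {n : ℕ} (u v : Fin n → ℝ) (a b : ℝ) :
    (a • u + b • v) ⬝ᵥ (a • u + b • v) ≤
      (2 * (u ⬝ᵥ u) + 2 * (v ⬝ᵥ v) + 1) * (a ^ 2 + b ^ 2) := by
  have nn : ∀ x : Fin n → ℝ, 0 ≤ x ⬝ᵥ x := fun x =>
    Finset.sum_nonneg fun i _ => mul_self_nonneg _
  have h := nn (a • u - b • v)
  have hu := mul_nonneg (sq_nonneg b) (nn u)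
  have hv := mul_nonneg (sq_nonneg a) (nn v)
  simp only [dotProduct_add, add_dotProduct, dotProduct_sub, sub_dotProduct,
    smul_dotProduct, dotProduct_smul, smul_eq_mul] at h ⊢
  nlinarith [sq_nonneg a, sq_nonneg b]

lemma qdf_single_vecMulVec {n : ℕ} (k : ℝ) (β : Fin n → ℝ) (w : ℝ → Fin n → ℝ) :
    qdf (Finsupp.single (0, 0) (k • Matrix.vecMulVec β β)) w = fun t => k * (β ⬝ᵥ w t) ^ 2 := by
  funext t
  rw [qdf, Finsupp.sum_single_index (by simp)]
  simp [Matrix.smul_mulVec, Matrix.vecMulVec_mulVec, dotProduct_smul, dotProduct_comm (w t) β, pow_two]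

lemma eventually_isStrictlyDissipative_firstOrder {n : ℕ} {S : Matrix (Fin n) (Fin n) ℝ}
    {u v : Fin n → ℝ} (huv : u ⬝ᵥ (S *ᵥ v) = 0) (hvu : v ⬝ᵥ (S *ᵥ u) = 0)
    (hu : 0 < u ⬝ᵥ (S *ᵥ u)) (β : Fin n → ℝ) :
    ∀ᶠ c : ℝ in atTop, IsStrictlyDissipative S (kerBehavior (firstOrderMatrix u v β c)) := by
  set α := u ⬝ᵥ (S *ᵥ u) with hα
  set μ := v ⬝ᵥ (S *ᵥ v) with hμ
  set K := 2 * (u ⬝ᵥ u) + 2 * (v ⬝ᵥ v) + 1 with hK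
  have hKpos : 0 < K := by
    have nn : ∀ x : Fin n → ℝ, 0 ≤ x ⬝ᵥ x := fun x =>
      Finset.sum_nonneg fun i _ => mul_self_nonneg _
    linarith [nn u, nn v]
  have hlim : Tendsto (fun c : ℝ => α / 2 * c ^ 2) atTop atTop :=
    (tendsto_pow_atTop two_ne_zero).const_mul_atTop (by linarith)
  filter_upwards [hlim.eventually_ge_atTop (α / 2 - μ)] with c hc
  -- Put a = f' + c f. The choice of ε gives ε|w|² ≤ (α/2)(a² + f²), and α a² + μ f² - (α/2)(a² +
  -- f²) = (α c f²/2)' + (α/2) f'² + (α c²/2 + μ - α/2) f², where the last coefficient is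
  -- nonnegative by `hc`.
  refine ⟨α / (2 * K), by positivity,
    Finsupp.single (0, 0) ((α * c / 2) • Matrix.vecMulVec β β), fun w hw t => ?_⟩
  obtain ⟨hs, e⟩ := mem_firstOrder_iff.1 hw
  have hf : DifferentiableAt ℝ (fun t => β ⬝ᵥ w t) t :=
    (contDiff_infty_iff_deriv.1 (contDiff_dotProduct β hs)).1 t
  have het : w t = _ := congrFun e t
  rw [qdf_single_vecMulVec, deriv_const_mul _ (hf.fun_pow 2), deriv_fun_pow hf, sub_smul_one_form]
  set d := deriv (fun t => β ⬝ᵥ w t) t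
  set b := β ⬝ᵥ w t
  rw [het, firstOrderTraj, form_add_of_orthogonal huv hvu, ← hα, ← hμ]
  have hle := mul_le_mul_of_nonneg_left (dotProduct_self_le u v (d + c * b) b)
    (show 0 ≤ α / (2 * K) by positivity)
  rw [← hK, ← mul_assoc, show α / (2 * K) * K = α / 2 by field_simp] at hle
  have h1 := mul_nonneg (sub_nonneg.2 hc) (sq_nonneg b)
  have h2 := mul_nonneg hu.le (sq_nonneg d)
  simp only [Nat.cast_ofNat, Nat.add_one_sub_one, pow_one]
  linarith

lemma exists_orthogonal_of_isIndefinite {n : ℕ} {S : Matrix (Fin n) (Fin n) ℝ} (hS : S.IsSymm)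
    (hind : IsIndefinite S) : ∃ u v : Fin n → ℝ,
      u ⬝ᵥ (S *ᵥ v) = 0 ∧ 0 < u ⬝ᵥ (S *ᵥ u) ∧ v ⬝ᵥ (S *ᵥ v) < 0 := by
  obtain ⟨⟨x, hx⟩, y, hy⟩ := hind
  have hxy := dotProduct_mulVec_comm_of_isSymm hS y x
  set q := x ⬝ᵥ (S *ᵥ y)
  set α := x ⬝ᵥ (S *ᵥ x)
  -- Gram–Schmidt for S: the correction lowers the value at y by q²/α, so it stays negative.
  refine ⟨x, y - (q / α) • x, ?_, hx, ?_⟩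
  · rw [Matrix.mulVec_sub, Matrix.mulVec_smul, dotProduct_sub, dotProduct_smul, smul_eq_mul,
      div_mul_cancel₀ _ hx.ne', sub_self]
  · have : (y - (q / α) • x) ⬝ᵥ (S *ᵥ (y - (q / α) • x)) = y ⬝ᵥ (S *ᵥ y) - q ^ 2 / α := by
      simp only [Matrix.mulVec_sub, Matrix.mulVec_smul, dotProduct_sub, sub_dotProduct,
        smul_dotProduct, dotProduct_smul, smul_eq_mul, hxy]
      change y ⬝ᵥ (S *ᵥ y) - q / α * q - q / α * (q - q / α * α) = _
      field_simp
      ring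
    rw [this]
    have : 0 ≤ q ^ 2 / α := by positivity
    linarith

/-! ### Intersection and existence -/

lemma isBehavior_inter {n : ℕ} {B C : Set (ℝ → Fin n → ℝ)} (hB : IsBehavior B)
    (hC : IsBehavior C) : IsBehavior (B ∩ C) := by
  obtain ⟨p, R, rfl⟩ := hB
  obtain ⟨q, Q, rfl⟩ := hC
  refine ⟨p + q, Matrix.of (Fin.append R Q), ?_⟩
  ext w
  have hsplit : ∀ t, diffOp (Matrix.of (Fin.append R Q)) w t = 0 ↔
      diffOp R w t = 0 ∧ diffOp Q w t = 0 := fun t => by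
    have hl : ∀ i j, Fin.append R Q (Fin.castAdd q i) j = R i j := fun i j =>
      congrFun (Fin.append_left R Q i) j
    have hr : ∀ i j, Fin.append R Q (Fin.natAdd p i) j = Q i j := fun i j =>
      congrFun (Fin.append_right R Q i) j
    simp only [funext_iff, diffOp, Matrix.of_apply, Pi.zero_apply, Fin.forall_fin_add, hl, hr]
  simp only [kerBehavior, Set.mem_inter_iff, Set.mem_ofPred_eq, hsplit, forall_and]
  tauto

theorem exists_isStrictIntersection {n : ℕ} {S : Matrix (Fin n) (Fin n) ℝ} (hS : S.IsSymm)
    (hind : IsIndefinite S) :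
    ∃ B : Set (ℝ → Fin n → ℝ), B ≠ {0} ∧ IsStrictIntersection S B := by
  obtain ⟨u, v, huv, hu, hv⟩ := exists_orthogonal_of_isIndefinite hS hind
  have hvu : v ⬝ᵥ (S *ᵥ u) = 0 := (dotProduct_mulVec_comm_of_isSymm hS v u).trans huv
  -- By S-orthogonality β and γ are dual to v and u, so each reads off the latent function of its
  -- behavior.
  let β : Fin n → ℝ := (v ⬝ᵥ (S *ᵥ v))⁻¹ • (S *ᵥ v)
  let γ : Fin n → ℝ := (u ⬝ᵥ (S *ᵥ u))⁻¹ • (S *ᵥ u)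
  have hβu : β ⬝ᵥ u = 0 := by simp [β, smul_dotProduct, dotProduct_comm (S *ᵥ v), huv]
  have hβv : β ⬝ᵥ v = 1 := by
    simp [β, smul_dotProduct, dotProduct_comm (S *ᵥ v), hv.ne]
  have hγv : γ ⬝ᵥ v = 0 := by simp [γ, smul_dotProduct, dotProduct_comm (S *ᵥ u), hvu]
  have hγu : γ ⬝ᵥ u = 1 := by
    simp [γ, smul_dotProduct, dotProduct_comm (S *ᵥ u), hu.ne']
  obtain ⟨c, hc₁, hc₂⟩ := ((eventually_isStrictlyDissipative_firstOrder huv hvu hu β).and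
    (eventually_isStrictlyDissipative_firstOrder (S := -S) (u := v) (v := u)
      (by simpa [Matrix.neg_mulVec] using hvu) (by simpa [Matrix.neg_mulVec] using huv)
      (by simpa [Matrix.neg_mulVec] using hv) γ)).exists
  have hb₁ : IsBehavior (kerBehavior (firstOrderMatrix u v β c)) := ⟨_, _, rfl⟩
  have hb₂ : IsBehavior (kerBehavior (firstOrderMatrix v u γ c)) := ⟨_, _, rfl⟩
  refine ⟨_, ?_, isBehavior_inter hb₁ hb₂, _, _,
    ⟨hb₁, isControllable_firstOrder c hβu hβv, hc₁⟩,
    ⟨hb₂, isControllable_firstOrder c hγv hγu, hc₂⟩, rfl⟩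
  -- The exponent is chosen so that f' + c f = f, making the trajectory symmetric in u and v.
  let f : ℝ → ℝ := fun t => Real.exp ((1 - c) * t)
  have hf : ContDiff ℝ ∞ f := Real.contDiff_exp.comp (contDiff_const.mul contDiff_id)
  have hder : ∀ t, deriv f t + c * f t = f t := fun t => by
    have : HasDerivAt f (f t * ((1 - c) * 1)) t :=
      ((hasDerivAt_id t).const_mul (1 - c)).exp
    rw [this.deriv]
    ring
  have heq : firstOrderTraj u v c f = firstOrderTraj v u c f := by
    funext t
    simp only [firstOrderTraj, hder, add_comm]
  intro h
  have hmem : firstOrderTraj u v c f ∈ ({0} : Set (ℝ → Fin n → ℝ)) :=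
    h ▸ ⟨firstOrderTraj_mem c hβu hβv hf, heq ▸ firstOrderTraj_mem c hγv hγu hf⟩
  have h0 := congrArg (β ⬝ᵥ ·) (congrFun (Set.mem_singleton_iff.1 hmem) 0)
  simp [firstOrderTraj, dotProduct_add, dotProduct_smul, hβu, hβv, f] at h0

end Behavioral

end

theorem mainTheorem4 {n : ℕ} (S : Matrix (Fin n) (Fin n) ℝ)
    (hns : IsUnit S.det) (hsymm : S.IsSymm) (hind : Behavioral.IsIndefinite S) :
    (∃ B : Set (ℝ → Fin n → ℝ), B ≠ {0} ∧ Behavioral.IsStrictIntersection S B) ∧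
    (∀ B : Set (ℝ → Fin n → ℝ),
      Behavioral.IsStrictIntersection S B → Behavioral.IsAutonomous B) :=
  ⟨Behavioral.exists_isStrictIntersection hsymm hind, fun _ hB => hB.isAutonomous⟩
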